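/- Let $I \subseteq \mathbb{R}$ be an open interval and let $f : I \to \mathbb{R}$ be of class $C^3$ with $f'(R) > 0$ for all $R \in I$. Assume (f1) $f(R) - R f'(R) < 0$ for all $R \in I$, and $\dfrac{f(R) - R f'(R)}{f'(R)^2} \to 0$ as $f'(R) \to \infty$; (f2) $2 f(R) - R f'(R) < 0$ for all $R \in I$; (f3) $\dfrac{R f'(R)}{f(R)} \to 2$ as $f'(R) \to \infty$. Let $-\infty < T < t_0 < T_+ \le \infty$, let $a : (T, T_+) \to (0, \infty)$ be of class $C^4$, and suppose that the spatially flat, homogeneous and isotropic metric $g = -dt^2 + a(t)^2 (dx^2 + dy^2 + dz^2)$ on $(T, T_+) \times \mathbb{R}^3$ has scalar curvature $R$ with values in $I$ and solves the vacuum $f(R)$ field equations $$ f'(R) R_{\alpha\beta} - \tfrac12 f(R) g_{\alpha\beta} - \nabla_\alpha \nabla_\beta (f'(R)) + \square (f'(R))\, g_{\alpha\beta} = 0 . $$ Write $H = \dot a / a$ for the Hubble parameter and $F(t) = f'(R(t))$. Suppose that $H > 0$ and $\dot F / F > 0$ at the initial time $t_0$, and that $F(t) \to \infty$ as $t \to T_+$.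 Then there is $t_1 \in [t_0, T_+)$ such that $\dot a(t) > 0$ and $\ddot a(t) > 0$ for all $t \in (t_1, T_+)$. In particular, if the solution exists globally to the future ($T_+ = \infty$), then the scale factor satisfies $\ddot a > 0$ for all sufficiently large $t$, and the expansion is accelerated at late times. -/

import Mathlib

open Filter Topology Set

noncomputable section

namespace FRGravity

/-- Points of a coordinate chart of a four-dimensional spacetime; the coordinate with index `0`
is the time `t`, the others are `x, y, z`. -/
abbrev Coord := Fin 4 → ℝ

/-- A (metric) tensor field with two lower indices, given by its components in the chart. -/
abbrev MetricField := Coord → Matrix (Fin 4) (Fin 4) ℝ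

/-- The partial derivative `∂_μ h` at `x`. -/
def partialD (μ : Fin 4) (h : Coord → ℝ) (x : Coord) : ℝ :=
  lineDeriv ℝ h x (Pi.single μ 1)

/-- The Christoffel symbol `Γ^γ_{αβ} = ½ g^{γδ} (∂_α g_{δβ} + ∂_β g_{δα} - ∂_δ g_{αβ})` of the
Levi-Civita connection of `g`. -/
def christoffel (g : MetricField) (γ α β : Fin 4) (x : Coord) : ℝ :=
  (1 / 2 : ℝ) * ∑ δ, (g x)⁻¹ γ δ *
    (partialD α (fun y => g y δ β) x + partialD β (fun y => g y δ α) x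
      - partialD δ (fun y => g y α β) x)

/-- The Ricci tensor
`R_{αβ} = ∂_γ Γ^γ_{αβ} - ∂_β Γ^γ_{αγ} + Γ^γ_{γδ} Γ^δ_{αβ} - Γ^γ_{βδ} Γ^δ_{αγ}`. -/
def ricci (g : MetricField) (α β : Fin 4) (x : Coord) : ℝ :=
  ∑ γ, (partialD γ (christoffel g γ α β) x - partialD β (christoffel g γ α γ) x
    + ∑ δ, (christoffel g γ γ δ x * christoffel g δ α β x
      - christoffel g γ β δ x * christoffel g δ α γ x))

/-- The scalar curvature `R = g^{αβ} R_{αβ}`. -/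
def scalarCurvature (g : MetricField) (x : Coord) : ℝ :=
  ∑ α, ∑ β, (g x)⁻¹ α β * ricci g α β x

/-- The second covariant derivative `∇_α ∇_β h = ∂_α ∂_β h - Γ^γ_{αβ} ∂_γ h` of a function. -/
def covHessian (g : MetricField) (h : Coord → ℝ) (α β : Fin 4) (x : Coord) : ℝ :=
  partialD α (partialD β h) x - ∑ γ, christoffel g γ α β x * partialD γ h x

/-- The d'Alembertian `□ h = g^{αβ} ∇_α ∇_β h` of a function. -/
def dAlembertian (g : MetricField) (h : Coord → ℝ) (x : Coord) : ℝ :=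
  ∑ α, ∑ β, (g x)⁻¹ α β * covHessian g h α β x

/-- The metric `g` solves, on the coordinate domain `U`, the vacuum `f(R)` field equations
`f'(R) R_{αβ} - ½ f(R) g_{αβ} - ∇_α ∇_β (f'(R)) + □ (f'(R)) g_{αβ} = 0`, where the function `f` has
the domain of definition `I`. -/
structure IsVacuumSolution (f : ℝ → ℝ) (I : Set ℝ) (U : Set Coord) (g : MetricField) : Prop where
  /-- The scalar curvature takes its values in the domain of `f`. -/
  curvature_mem : ∀ x ∈ U, scalarCurvature g x ∈ I
  /-- The field equations. -/
  field_eq : ∀ x ∈ U, ∀ α β : Fin 4,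
    deriv f (scalarCurvature g x) * ricci g α β x - (1 / 2 : ℝ) * f (scalarCurvature g x) * g x α β
      - covHessian g (fun y => deriv f (scalarCurvature g y)) α β x
      + dAlembertian g (fun y => deriv f (scalarCurvature g y)) x * g x α β = 0

/-- The spatially flat FLRW metric `-dt² + a(t)² (dx² + dy² + dz²)` with scale factor `a`. -/
def flatFLRW (a : ℝ → ℝ) : MetricField := fun x =>
  Matrix.diagonal ![-1, a (x 0) ^ 2, a (x 0) ^ 2, a (x 0) ^ 2]

/-- The Hubble parameter `H = ȧ / a`. -/
def hubble (a : ℝ → ℝ) (t : ℝ) : ℝ := deriv a t / a t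

/-- The function `F = f'(R)` of time for the spatially flat FLRW metric. The scalar curvature of
this metric is constant on the slices of constant time, so it is evaluated at the spatial origin. -/
def flrwF (f a : ℝ → ℝ) (t : ℝ) : ℝ :=
  deriv f (scalarCurvature (flatFLRW a) ![t, 0, 0, 0])

/-- The time interval `(T, T₊)`, where the end `T₊` may be `∞`. -/
def timeInterval (T : ℝ) (Tend : EReal) : Set ℝ := {t | T < t ∧ (t : EReal) < Tend}

/-- The filter `t → T₊` (from below) of real times, where the end `T₊` may be `∞`. -/
def futureEnd (Tend : EReal) : Filter ℝ := comap Real.toEReal (𝓝[<] Tend)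

theorem timeInterval_top (T : ℝ) : timeInterval T ⊤ = Ioi T := by
  ext t
  simp [timeInterval, EReal.coe_lt_top]

theorem futureEnd_top : futureEnd ⊤ = atTop := by
  have h : 𝓝[<] (⊤ : EReal) = map Real.toEReal atTop := by
    rw [← EReal.nhdsWithin_top]
    congr 1
    ext x
    simp [lt_top_iff_ne_top]
  rw [futureEnd, h, comap_map EReal.coe_injective]

/-- The filter on the domain `I` of `f` that describes `f'(R) → ∞`. -/
def derivToInfty (f : ℝ → ℝ) (I : Set ℝ) : Filter ℝ := comap (deriv f) atTop ⊓ 𝓟 I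

/-- `f(R) - R f'(R) < 0`, and `(f(R) - R f'(R)) / f'(R)² → 0` as `f'(R) → ∞`. -/
def ConditionF1 (f : ℝ → ℝ) (I : Set ℝ) : Prop :=
  (∀ r ∈ I, f r - r * deriv f r < 0) ∧
    Tendsto (fun r => (f r - r * deriv f r) / deriv f r ^ 2) (derivToInfty f I) (𝓝 0)

/-- `2 f(R) - R f'(R) < 0` for all `R`. -/
def ConditionF2 (f : ℝ → ℝ) (I : Set ℝ) : Prop :=
  ∀ r ∈ I, 2 * f r - r * deriv f r < 0

/-- `R f'(R) / f(R) → 2` as `f'(R) → ∞`. -/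
def ConditionF3 (f : ℝ → ℝ) (I : Set ℝ) : Prop :=
  Tendsto (fun r => r * deriv f r / f r) (derivToInfty f I) (𝓝 2)

end FRGravity

end

namespace FRGravity

/-! ### Curvature and wave operator of the flat FLRW metric. -/

section Homogeneous

/-! Homogeneity and isotropy reduce the field equations to two scalar ODEs (`friedmann_and_trace`),
with `R = 6 (ä/a + H²)`: the Friedmann equation `6H(HF + Ḟ) = RF - f` and the trace `3(F̈ + 3HḞ) =
RF - 2f`.

By (f1) the right side of the first is positive, so `H` cannot vanish and keeps its initial sign. By
(f2) the right side of the second is positive, so `a³Ḟ` increases and `Ḟ` stays positive after `t₀`.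
Substituting `R` into the Friedmann equation cancels the `H²F` terms and leaves `6F ä/a = 6HḞ + f`.
Finally (f1) and (f3) force `f > 0` once `F` is large, hence `ä > 0` near the end of the time
interval. -/

theorem partialD_comp_time (φ : ℝ → ℝ) (μ : Fin 4) (x : Coord) :
    partialD μ (fun y => φ (y 0)) x = if μ = 0 then deriv φ (x 0) else 0 := by
  unfold partialD lineDeriv
  split_ifs with h
  · subst h
    have := deriv_comp_const_add (f := φ) (x 0) 0
    simpa using this
  · have h0 : (Pi.single μ (1 : ℝ) : Coord) 0 = 0 := Pi.single_eq_of_ne (Ne.symm h) _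
    simp [h0]

/-- The Christoffel symbols of the spatially flat FLRW metric, as functions of time. -/
noncomputable def flrwGamma (a : ℝ → ℝ) (γ α β : Fin 4) (t : ℝ) : ℝ :=
  if γ = 0 then (if α = β ∧ α ≠ 0 then a t * deriv a t else 0)
  else if (α = 0 ∧ β = γ) ∨ (β = 0 ∧ α = γ) then hubble a t else 0

theorem flatFLRW_inv {a : ℝ → ℝ} {x : Coord} (h : a (x 0) ≠ 0) :
    (flatFLRW a x)⁻¹ = Matrix.diagonal
      ![-1, (a (x 0) ^ 2)⁻¹, (a (x 0) ^ 2)⁻¹, (a (x 0) ^ 2)⁻¹] := by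
  apply Matrix.inv_eq_right_inv
  rw [flatFLRW, Matrix.diagonal_mul_diagonal, ← Matrix.diagonal_one]
  congr 1
  ext i
  fin_cases i <;> simp [h]

theorem partialD_flatFLRW {a : ℝ → ℝ} {x : Coord} (h : DifferentiableAt ℝ a (x 0))
    (μ α β : Fin 4) :
    partialD μ (fun y => flatFLRW a y α β) x =
      if μ = 0 ∧ α = β ∧ α ≠ 0 then 2 * a (x 0) * deriv a (x 0) else 0 := by
  have hd : deriv (fun t => a t ^ 2) (x 0) = 2 * a (x 0) * deriv a (x 0) := by
    rw [(h.hasDerivAt.fun_pow 2).deriv]; simp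
  have := partialD_comp_time
    (fun t => (Matrix.diagonal ![-1, a t ^ 2, a t ^ 2, a t ^ 2] : Matrix (Fin 4) (Fin 4) ℝ) α β) μ x
  simp only [flatFLRW]
  rw [this]
  by_cases hμ : μ = 0 <;> by_cases hαβ : α = β
  · subst hαβ
    fin_cases α <;> simp [hμ, hd]
  · simp [hμ, hαβ]
  · simp [hμ]
  · simp [hμ]

theorem christoffel_flatFLRW {a : ℝ → ℝ} {x : Coord} (h0 : a (x 0) ≠ 0)
    (h : DifferentiableAt ℝ a (x 0)) (γ α β : Fin 4) :
    christoffel (flatFLRW a) γ α β x = flrwGamma a γ α β (x 0) := by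
  simp only [christoffel, partialD_flatFLRW h, flatFLRW_inv h0, flrwGamma, hubble]
  fin_cases γ <;> fin_cases α <;> fin_cases β <;>
    simp [Fin.sum_univ_four, Matrix.diagonal] <;> field_simp

theorem partialD_congr {h k : Coord → ℝ} {x : Coord} (μ : Fin 4) (e : h =ᶠ[𝓝 x] k) :
    partialD μ h x = partialD μ k x := e.lineDeriv_eq

variable {a : ℝ → ℝ} {J : Set ℝ}

theorem eventually_time_mem (hJ : IsOpen J) {x : Coord} (hx : x 0 ∈ J) : ∀ᶠ y in 𝓝 x, y 0 ∈ J :=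
  (continuous_apply 0).continuousAt.eventually (hJ.mem_nhds hx)

theorem partialD_christoffel_flatFLRW (hJ : IsOpen J) (ha_pos : ∀ t ∈ J, 0 < a t)
    (hd : ∀ t ∈ J, DifferentiableAt ℝ a t) {x : Coord} (hx : x 0 ∈ J) (μ γ α β : Fin 4) :
    partialD μ (christoffel (flatFLRW a) γ α β) x =
      if μ = 0 then deriv (flrwGamma a γ α β) (x 0) else 0 := by
  rw [← partialD_comp_time]
  apply partialD_congr
  filter_upwards [eventually_time_mem hJ hx] with y hy
  exact christoffel_flatFLRW (ha_pos _ hy).ne' (hd _ hy) γ α β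

theorem deriv_flrwGamma {t : ℝ} (h0 : a t ≠ 0) (h : DifferentiableAt ℝ a t)
    (h2 : DifferentiableAt ℝ (deriv a) t) (γ α β : Fin 4) :
    deriv (flrwGamma a γ α β) t =
      if γ = 0 then (if α = β ∧ α ≠ 0 then deriv a t ^ 2 + a t * deriv (deriv a) t else 0)
      else if (α = 0 ∧ β = γ) ∨ (β = 0 ∧ α = γ) then
        deriv (deriv a) t / a t - hubble a t ^ 2 else 0 := by
  unfold flrwGamma
  split_ifs
  · rw [(h.hasDerivAt.fun_mul h2.hasDerivAt).deriv]; ring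
  · simp
  · have := (h2.hasDerivAt.div h.hasDerivAt h0).deriv
    rw [show (fun t => hubble a t) = deriv a / a from rfl, this, hubble]
    field_simp
  · simp

/-- Diagonal components suffice: the inverse metric is diagonal, and only the `tt` and `xx` field
equations are used. -/
theorem ricci_flatFLRW (hJ : IsOpen J) (ha_pos : ∀ t ∈ J, 0 < a t)
    (hd : ∀ t ∈ J, DifferentiableAt ℝ a t) (hd2 : ∀ t ∈ J, DifferentiableAt ℝ (deriv a) t)
    {x : Coord} (hx : x 0 ∈ J) (α : Fin 4) :
    ricci (flatFLRW a) α α x =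
      if α = 0 then -3 * (deriv (deriv a) (x 0) / a (x 0))
      else a (x 0) * deriv (deriv a) (x 0) + 2 * deriv a (x 0) ^ 2 := by
  have h0 := (ha_pos _ hx).ne'
  simp only [ricci, partialD_christoffel_flatFLRW hJ ha_pos hd hx,
    deriv_flrwGamma h0 (hd _ hx) (hd2 _ hx), christoffel_flatFLRW h0 (hd _ hx)]
  fin_cases α <;> simp [Fin.sum_univ_four, flrwGamma, hubble] <;> field_simp <;> ring

/-- The scalar curvature `6 (ä / a + H²)` of the spatially flat FLRW metric. -/
noncomputable def flrwScalar (a : ℝ → ℝ) (t : ℝ) : ℝ := 6 * (deriv (deriv a) t / a t + hubble a t ^ 2)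

theorem scalarCurvature_flatFLRW (hJ : IsOpen J) (ha_pos : ∀ t ∈ J, 0 < a t)
    (hd : ∀ t ∈ J, DifferentiableAt ℝ a t) (hd2 : ∀ t ∈ J, DifferentiableAt ℝ (deriv a) t)
    {x : Coord} (hx : x 0 ∈ J) :
    scalarCurvature (flatFLRW a) x = flrwScalar a (x 0) := by
  have h0 := (ha_pos _ hx).ne'
  simp only [scalarCurvature, flatFLRW_inv h0, Matrix.diagonal_apply, ite_mul, zero_mul,
    Finset.sum_ite_eq, Finset.mem_univ, if_true, ricci_flatFLRW hJ ha_pos hd hd2 hx]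
  simp [Fin.sum_univ_four, flrwScalar, hubble]
  field_simp
  ring

/-- Agreement of `h` with `φ` is required only over `J`, since for `h = f'(R)` the curvature formula
holds only there; openness of `J` makes this enough for derivatives. -/
theorem covHessian_flatFLRW (hJ : IsOpen J) (ha_pos : ∀ t ∈ J, 0 < a t)
    (hd : ∀ t ∈ J, DifferentiableAt ℝ a t) {h : Coord → ℝ} {φ : ℝ → ℝ}
    (hφ : ∀ y : Coord, y 0 ∈ J → h y = φ (y 0)) {x : Coord} (hx : x 0 ∈ J) (α : Fin 4) :
    covHessian (flatFLRW a) h α α x =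
      if α = 0 then deriv (deriv φ) (x 0) else -(a (x 0) * deriv a (x 0) * deriv φ (x 0)) := by
  have h0 := (ha_pos _ hx).ne'
  have e1 : ∀ μ : Fin 4, ∀ y : Coord, y 0 ∈ J →
      partialD μ h y = if μ = 0 then deriv φ (y 0) else 0 := fun μ y hy => by
    rw [← partialD_comp_time]
    apply partialD_congr
    filter_upwards [eventually_time_mem hJ hy] with z hz using hφ z hz
  have e2 : partialD α (partialD α h) x = if α = 0 then deriv (deriv φ) (x 0) else 0 := by
    have e3 : partialD α h =ᶠ[𝓝 x] fun y => (fun t => if α = 0 then deriv φ t else 0) (y 0) := by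
      filter_upwards [eventually_time_mem hJ hx] with z hz using e1 α z hz
    rw [partialD_congr α e3, partialD_comp_time (fun t => if α = 0 then deriv φ t else 0)]
    split_ifs <;> rfl
  simp only [covHessian, e2, e1 _ x hx, christoffel_flatFLRW h0 (hd _ hx)]
  fin_cases α <;> simp [flrwGamma]

theorem dAlembertian_flatFLRW (hJ : IsOpen J) (ha_pos : ∀ t ∈ J, 0 < a t)
    (hd : ∀ t ∈ J, DifferentiableAt ℝ a t) {h : Coord → ℝ} {φ : ℝ → ℝ}
    (hφ : ∀ y : Coord, y 0 ∈ J → h y = φ (y 0)) {x : Coord} (hx : x 0 ∈ J) :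
    dAlembertian (flatFLRW a) h x =
      -deriv (deriv φ) (x 0) - 3 * hubble a (x 0) * deriv φ (x 0) := by
  have h0 := (ha_pos _ hx).ne'
  simp only [dAlembertian, flatFLRW_inv h0, Matrix.diagonal_apply, ite_mul, zero_mul,
    Finset.sum_ite_eq, Finset.mem_univ, if_true, covHessian_flatFLRW hJ ha_pos hd hφ hx]
  simp [Fin.sum_univ_four, hubble]
  field_simp
  ring

end Homogeneous

/-! ### Reduction of the field equations to ODEs. -/

section FieldEquations

variable {a f : ℝ → ℝ} {I J : Set ℝ}

theorem flrwF_eq (hJ : IsOpen J) (ha_pos : ∀ t ∈ J, 0 < a t)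
    (hd : ∀ t ∈ J, DifferentiableAt ℝ a t) (hd2 : ∀ t ∈ J, DifferentiableAt ℝ (deriv a) t)
    {t : ℝ} (ht : t ∈ J) : flrwF f a t = deriv f (flrwScalar a t) := by
  rw [flrwF, scalarCurvature_flatFLRW (x := ![t, 0, 0, 0]) hJ ha_pos hd hd2 ht]
  rfl

theorem flrwScalar_mem (hJ : IsOpen J) (ha_pos : ∀ t ∈ J, 0 < a t)
    (hd : ∀ t ∈ J, DifferentiableAt ℝ a t) (hd2 : ∀ t ∈ J, DifferentiableAt ℝ (deriv a) t)
    (hsol : IsVacuumSolution f I {x | x 0 ∈ J} (flatFLRW a)) {t : ℝ} (ht : t ∈ J) :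
    flrwScalar a t ∈ I := by
  have := hsol.curvature_mem ![t, 0, 0, 0] ht
  rwa [scalarCurvature_flatFLRW (x := ![t, 0, 0, 0]) hJ ha_pos hd hd2 ht] at this

/-- The modified Friedmann equation and the trace of the field equations. -/
theorem friedmann_and_trace (hJ : IsOpen J) (ha_pos : ∀ t ∈ J, 0 < a t)
    (hd : ∀ t ∈ J, DifferentiableAt ℝ a t) (hd2 : ∀ t ∈ J, DifferentiableAt ℝ (deriv a) t)
    (hsol : IsVacuumSolution f I {x | x 0 ∈ J} (flatFLRW a)) {t : ℝ} (ht : t ∈ J) :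
    6 * hubble a t * (hubble a t * flrwF f a t + deriv (flrwF f a) t) =
        flrwScalar a t * flrwF f a t - f (flrwScalar a t) ∧
      3 * (deriv (deriv (flrwF f a)) t + 3 * hubble a t * deriv (flrwF f a) t) =
        flrwScalar a t * flrwF f a t - 2 * f (flrwScalar a t) := by
  set x : Coord := ![t, 0, 0, 0]
  have hx0 : x 0 = t := rfl
  have hx : x 0 ∈ J := ht
  have h0 : a t ≠ 0 := (ha_pos _ ht).ne'
  have hφ : ∀ y : Coord, y 0 ∈ J →
      deriv f (scalarCurvature (flatFLRW a) y) = flrwF f a (y 0) := fun y hy => by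
    rw [scalarCurvature_flatFLRW hJ ha_pos hd hd2 hy, flrwF_eq hJ ha_pos hd hd2 hy]
  have E0 := hsol.field_eq x hx 0 0
  have E1 := hsol.field_eq x hx 1 1
  rw [hφ x hx, scalarCurvature_flatFLRW hJ ha_pos hd hd2 hx, ricci_flatFLRW hJ ha_pos hd hd2 hx,
    covHessian_flatFLRW hJ ha_pos hd hφ hx, dAlembertian_flatFLRW hJ ha_pos hd hφ hx] at E0 E1
  simp only [hx0, flatFLRW, Matrix.diagonal_apply_eq, one_ne_zero, if_true, if_false,
    Matrix.cons_val_zero, Matrix.cons_val_one] at E0 E1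
  have hS : deriv (deriv a) t / a t = flrwScalar a t / 6 - hubble a t ^ 2 := by
    rw [flrwScalar]; ring
  have hdda : deriv (deriv a) t = (flrwScalar a t / 6 - hubble a t ^ 2) * a t := by
    rw [← hS]; field_simp
  have hda : deriv a t = hubble a t * a t := by rw [hubble]; field_simp
  rw [hS] at E0
  rw [hdda, hda] at E1
  -- The `xx` equation divided by `a²`.
  have E2 : flrwF f a t * (flrwScalar a t / 6 + hubble a t ^ 2) - f (flrwScalar a t) / 2
      - deriv (deriv (flrwF f a)) t - 2 * hubble a t * deriv (flrwF f a) t = 0 := by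
    have h2 : a t ^ 2 ≠ 0 := pow_ne_zero 2 h0
    apply mul_left_cancel₀ h2
    linear_combination E1
  constructor
  -- In the `tt` equation the `F̈` of the Hessian cancels that of `□F`.
  · linear_combination 2 * E0
  -- Minus the metric trace: `-1` for time, three equal spatial terms.
  · linear_combination E0 - 3 * E2

/-- `R` contains `ä`, so it costs two of the four derivatives of `a`, and `f'` costs one of the
three of `f`. Order 2 is what makes `Ḟ` differentiable. -/
theorem contDiffOn_flrwF (hJ : IsOpen J) (hI : IsOpen I) (hf : ContDiffOn ℝ 3 f I)
    (ha : ContDiffOn ℝ 4 a J) (ha_pos : ∀ t ∈ J, 0 < a t)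
    (hd : ∀ t ∈ J, DifferentiableAt ℝ a t) (hd2 : ∀ t ∈ J, DifferentiableAt ℝ (deriv a) t)
    (hmem : ∀ t ∈ J, flrwScalar a t ∈ I) : ContDiffOn ℝ 2 (flrwF f a) J := by
  have ha1 : ContDiffOn ℝ 3 (deriv a) J := ha.deriv_of_isOpen hJ (by norm_num)
  have ha2 : ContDiffOn ℝ 2 (deriv (deriv a)) J := ha1.deriv_of_isOpen hJ (by norm_num)
  have ha0 : ∀ t ∈ J, a t ≠ 0 := fun t ht => (ha_pos t ht).ne'
  have hf1 : ContDiffOn ℝ 2 (deriv f) I := hf.deriv_of_isOpen hI (by norm_num)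
  have haa : ContDiffOn ℝ 2 a J := ha.of_le (by norm_num)
  have hS : ContDiffOn ℝ 2 (flrwScalar a) J :=
    contDiffOn_const.mul ((ha2.div haa ha0).add
      (((ha1.of_le (by norm_num)).div haa ha0).pow 2))
  exact (hf1.comp hS hmem).congr fun t ht => flrwF_eq hJ ha_pos hd hd2 ht

end FieldEquations

/-! ### Persistence of signs. -/

section Persistence

/-- On an order connected set, a continuous nowhere vanishing function keeps its sign. -/
theorem pos_of_ne_zero_of_ordConnected {J : Set ℝ} (hJ : J.OrdConnected) {h : ℝ → ℝ}
    (hc : ContinuousOn h J) (hne : ∀ t ∈ J, h t ≠ 0) {s t : ℝ} (hs : s ∈ J) (hpos : 0 < h s)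
    (ht : t ∈ J) : 0 < h t := by
  by_contra hcon
  obtain ⟨u, hu, hu0⟩ := hJ.isPreconnected.intermediate_value ht hs hc ⟨not_lt.mp hcon, hpos.le⟩
  exact hne u hu hu0

/-- If `(a³ φ)˙ > 0` and `φ` is positive initially, then `φ` stays positive. -/
theorem pos_of_deriv_add_pos {J : Set ℝ} (hJ : J.OrdConnected) {a φ : ℝ → ℝ}
    (ha_pos : ∀ t ∈ J, 0 < a t) (hd : ∀ t ∈ J, DifferentiableAt ℝ a t)
    (hφ : ∀ t ∈ J, DifferentiableAt ℝ φ t)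
    (hineq : ∀ t ∈ J, 0 < deriv φ t + 3 * hubble a t * φ t) {s t : ℝ} (hs : s ∈ J)
    (hpos : 0 < φ s) (ht : t ∈ J) (hst : s ≤ t) : 0 < φ t := by
  -- `a³` is the integrating factor of `φ̇ + 3Hφ`, because `(a³)˙ = 3H a³`.
  have hder : ∀ u ∈ J, HasDerivAt (fun t => a t ^ 3 * φ t)
      (a u ^ 3 * (deriv φ u + 3 * hubble a u * φ u)) u := fun u hu => by
    have h0 : a u ≠ 0 := (ha_pos u hu).ne'
    refine (((hd u hu).hasDerivAt.fun_pow 3).fun_mul (hφ u hu).hasDerivAt).congr_deriv ?_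
    rw [hubble]
    field_simp
    push_cast
    ring
  have hmono : StrictMonoOn (fun t => a t ^ 3 * φ t) J := by
    apply strictMonoOn_of_deriv_pos hJ.convex
    · exact fun u hu => (hder u hu).continuousAt.continuousWithinAt
    · intro u hu
      have hu' := interior_subset hu
      rw [(hder u hu').deriv]
      exact mul_pos (pow_pos (ha_pos u hu') 3) (hineq u hu')
  have hle : a s ^ 3 * φ s ≤ a t ^ 3 * φ t := hmono.monotoneOn hs ht hst
  exact pos_of_mul_pos_right ((mul_pos (pow_pos (ha_pos s hs) 3) hpos).trans_le hle)
    (pow_pos (ha_pos t ht) 3).le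

end Persistence

/-! ### The time interval and its future end. -/

section Time

theorem isOpen_timeInterval (T : ℝ) (Tend : EReal) : IsOpen (timeInterval T Tend) :=
  (isOpen_lt continuous_const continuous_id).inter
    (isOpen_lt continuous_coe_real_ereal continuous_const)

theorem ordConnected_timeInterval (T : ℝ) (Tend : EReal) : (timeInterval T Tend).OrdConnected :=
  ⟨fun _ hx _ hy _ hz => ⟨hx.1.trans_le hz.1, (EReal.coe_le_coe hz.2).trans_lt hy.2⟩⟩

theorem eventually_futureEnd {T s : ℝ} {Tend : EReal} (hs : s ∈ timeInterval T Tend) :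
    ∀ᶠ t in futureEnd Tend, t ∈ timeInterval T Tend ∧ s ≤ t := by
  have h : Ioo (s : EReal) Tend ∈ 𝓝[<] Tend := Ioo_mem_nhdsLT hs.2
  filter_upwards [preimage_mem_comap h] with t ht
  have hst : s < t := EReal.coe_lt_coe_iff.mp ht.1
  exact ⟨⟨hs.1.trans hst, ht.2⟩, hst.le⟩

end Time

/-- By `(f1)` and `(f3)`, the function `f` is positive where `f'` is large. -/
theorem eventually_pos_of_conditions {f : ℝ → ℝ} {I : Set ℝ} (hf1 : ConditionF1 f I)
    (hf3 : ConditionF3 f I) : ∀ᶠ r in derivToInfty f I, 0 < f r := by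
  have hI : ∀ᶠ r in derivToInfty f I, r ∈ I := mem_inf_of_right (mem_principal_self I)
  filter_upwards [hI, hf3.eventually (lt_mem_nhds (show (1 : ℝ) < 2 by norm_num))] with r hr h3
  have h1 := hf1.1 r hr
  rcases lt_trichotomy (f r) 0 with h | h | h
  -- For `f < 0`, the bound `RF/f > 1` becomes `RF < f`, against (f1).
  · rw [lt_div_iff_of_neg h] at h3
    linarith
  -- For `f = 0` the quotient is `0` by convention, which is not above `1`.
  · simp only [h, div_zero] at h3
    linarith
  · exact h

end FRGravity

theorem theorem4 (f : ℝ → ℝ) (I : Set ℝ) (hI_open : IsOpen I) (hI_interval : I.OrdConnected)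
    (hf : ContDiffOn ℝ 3 f I) (hf_pos : ∀ r ∈ I, 0 < deriv f r)
    (hf1 : FRGravity.ConditionF1 f I) (hf2 : FRGravity.ConditionF2 f I)
    (hf3 : FRGravity.ConditionF3 f I)
    (a : ℝ → ℝ) (T t₀ : ℝ) (Tend : EReal) (ht₀ : t₀ ∈ FRGravity.timeInterval T Tend)
    (ha : ContDiffOn ℝ 4 a (FRGravity.timeInterval T Tend)) (ha_pos : ∀ t ∈ FRGravity.timeInterval T Tend, 0 < a t)
    (hsol : FRGravity.IsVacuumSolution f I {x | x 0 ∈ FRGravity.timeInterval T Tend}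
      (FRGravity.flatFLRW a))
    (hH : 0 < FRGravity.hubble a t₀)
    (hF : 0 < deriv (FRGravity.flrwF f a) t₀ / FRGravity.flrwF f a t₀)
    (hlim : Filter.Tendsto (FRGravity.flrwF f a) (FRGravity.futureEnd Tend) Filter.atTop) :
    ∀ᶠ t in FRGravity.futureEnd Tend, 0 < deriv a t ∧ 0 < deriv (deriv a) t := by
  have hJ := FRGravity.isOpen_timeInterval T Tend
  have hJc := FRGravity.ordConnected_timeInterval T Tend
  set J := FRGravity.timeInterval T Tend
  have hd : ∀ t ∈ J, DifferentiableAt ℝ a t := fun t ht =>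
    (ha.differentiableOn (by norm_num)).differentiableAt (hJ.mem_nhds ht)
  have ha1 : ContDiffOn ℝ 3 (deriv a) J := ha.deriv_of_isOpen hJ (by norm_num)
  have hd2 : ∀ t ∈ J, DifferentiableAt ℝ (deriv a) t := fun t ht =>
    (ha1.differentiableOn (by norm_num)).differentiableAt (hJ.mem_nhds ht)
  have hmem : ∀ t ∈ J, FRGravity.flrwScalar a t ∈ I := fun t ht =>
    FRGravity.flrwScalar_mem hJ ha_pos hd hd2 hsol ht
  have hFeq : ∀ t ∈ J, FRGravity.flrwF f a t = deriv f (FRGravity.flrwScalar a t) := fun t ht =>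
    FRGravity.flrwF_eq hJ ha_pos hd hd2 ht
  have hFpos : ∀ t ∈ J, 0 < FRGravity.flrwF f a t := fun t ht =>
    hFeq t ht ▸ hf_pos _ (hmem t ht)
  have hFC := FRGravity.contDiffOn_flrwF hJ hI_open hf ha ha_pos hd hd2 hmem
  have hF1C : ContDiffOn ℝ 1 (deriv (FRGravity.flrwF f a)) J :=
    hFC.deriv_of_isOpen hJ (by norm_num)
  have hfield := fun t ht => FRGravity.friedmann_and_trace (t := t) hJ ha_pos hd hd2 hsol ht
  have hFr : ∀ t ∈ J, 0 < 6 * FRGravity.hubble a t *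
      (FRGravity.hubble a t * FRGravity.flrwF f a t + deriv (FRGravity.flrwF f a) t) :=
    fun t ht => by
      rw [(hfield t ht).1, hFeq t ht]
      linarith [hf1.1 _ (hmem t ht)]
  -- A zero of `H` would annihilate the left side of the Friedmann equation.
  have hHpos : ∀ t ∈ J, 0 < FRGravity.hubble a t := fun t ht =>
    FRGravity.pos_of_ne_zero_of_ordConnected hJc
      (ha1.continuousOn.div ha.continuousOn fun u hu => (ha_pos u hu).ne')
      (fun u hu h0 => by
        have h := hFr u hu
        change FRGravity.hubble a u = 0 at h0
        rw [h0, mul_zero, zero_mul] at h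
        exact lt_irrefl _ h) ht₀ hH ht
  have hF0 : 0 < deriv (FRGravity.flrwF f a) t₀ := by
    rwa [div_pos_iff_of_pos_right (hFpos t₀ ht₀)] at hF
  have hFdot : ∀ t ∈ J, t₀ ≤ t → 0 < deriv (FRGravity.flrwF f a) t := fun t ht hle =>
    FRGravity.pos_of_deriv_add_pos hJc ha_pos hd
      (fun u hu => (hF1C.differentiableOn (by norm_num)).differentiableAt (hJ.mem_nhds hu))
      (fun u hu => by
        have h := (hfield u hu).2
        rw [hFeq u hu] at h
        linarith [hf2 _ (hmem u hu)])
      ht₀ hF0 ht hle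
  have hev := FRGravity.eventually_futureEnd ht₀
  -- Transports asymptotics in `R` as `f'(R) → ∞` to asymptotics in time.
  have hR : Filter.Tendsto (FRGravity.flrwScalar a) (FRGravity.futureEnd Tend)
      (FRGravity.derivToInfty f I) := by
    refine Filter.tendsto_inf.mpr ⟨Filter.tendsto_comap_iff.mpr (hlim.congr' ?_),
      Filter.tendsto_principal.mpr ?_⟩
    · filter_upwards [hev] with t ht using hFeq t ht.1
    · filter_upwards [hev] with t ht using hmem t ht.1
  filter_upwards [hev, hR.eventually (FRGravity.eventually_pos_of_conditions hf1 hf3)]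
    with t ht hft
  have hat := ha_pos t ht.1
  have hHt := hHpos t ht.1
  refine ⟨(div_pos_iff_of_pos_right hat).mp hHt, (div_pos_iff_of_pos_right hat).mp ?_⟩
  have key : deriv (deriv a) t / a t * (6 * FRGravity.flrwF f a t) =
      6 * (FRGravity.hubble a t * deriv (FRGravity.flrwF f a) t)
        + f (FRGravity.flrwScalar a t) := by
    have h := (hfield t ht.1).1
    have hS : FRGravity.flrwScalar a t * FRGravity.flrwF f a t =
        6 * (deriv (deriv a) t / a t + FRGravity.hubble a t ^ 2) * FRGravity.flrwF f a t := rfl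
    linear_combination -h - hS
  have hrhs : 0 < deriv (deriv a) t / a t * (6 * FRGravity.flrwF f a t) := by
    rw [key]
    have := mul_pos hHt (hFdot t ht.1 ht.2)
    positivity
  exact pos_of_mul_pos_left hrhs (by linarith [hFpos t ht.1])
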